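/- **Setting.** Let $(X,d)$ be a nonempty complete metric space, write $\mathbb N^*=\{0,1,2,\dots\}$, let $\mathbb K(X)$ be the family of nonempty compact subsets of $X$ with the Hausdorff metric, and for a metric space $Y$ let $\ell_\infty(Y)$ be the space of bounded sequences $(y_i)_{i\in\mathbb N^*}$ in $Y$ with the supremum metric. Put $X_0^\infty=X$ and $X_{k+1}^\infty=\ell_\infty(X_k^\infty)$. For a set $S$ put $S_0=S$ and $S_{k+1}=S_k\times S_k\times\cdots$ (all sequences in $S_k$). Let $n\ge 1$ and let $\mathcal F=\{f_1,\dots,f_n\}$ be a GIFS$_\infty$ satisfying $(S_1)$, that is, maps $f_i:\ell_\infty(X)\to X$ such that $\max_i\operatorname{Lip}(f_i)<1$ and, for every $i$ and every $(K_k)\in\ell_\infty(\mathbb K(X))$, $\overline{f_i(\prod_k K_k)}\in\mathbb K(X)$. An attractor of $\mathcal F$ is a set $A\in\mathbb K(X)$ with $A=\bigcup_{i=1}^n\overline{f_i(A\times A\times\cdots)}$. Let $\Omega=\{1,\dots,n\}$, ${}_k\Omega=\Omega_0\times\cdots\times\Omega_k$ and $\mathbf\Omega=\prod_{k=0}^\infty\Omega_k$.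 For $\alpha=(\alpha_0,\alpha_1,\dots)\in\mathbf\Omega$ put $\alpha|_k=(\alpha_0,\dots,\alpha_k)$. For $\alpha=(\alpha_0,\dots,\alpha_{k+1})\in{}_{k+1}\Omega$ and $i\in\mathbb N^*$ put $\alpha(i)=(\alpha_1^{(i)},\dots,\alpha_{k+1}^{(i)})\in{}_k\Omega$, where $\alpha_j^{(i)}\in\Omega_{j-1}$ is the $i$-th term of the sequence $\alpha_j\in\Omega_j$. For $\alpha\in{}_k\Omega$ define $f_\alpha:X_{k+1}^\infty\to X$ by $f_{(j)}=f_j$ and, for $\alpha\in{}_{k+1}\Omega$, $$f_\alpha(x_0,x_1,\dots)=f_{\alpha_0}\big(f_{\alpha(0)}(x_0),f_{\alpha(1)}(x_1),\dots\big).$$ For $j\in\Omega$ and $\beta_i=(\beta_i^{(0)},\beta_i^{(1)},\dots)\in\mathbf\Omega$ let $$\tau_j(\beta_0,\beta_1,\dots)=\big(j,(\beta_0^{(0)},\beta_1^{(0)},\dots),(\beta_0^{(1)},\beta_1^{(1)},\dots),\dots\big)\in\mathbf\Omega .$$ With $\Pi=\mathbf\Omega$ and $\Pi_k$ the iterated products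 as above, define $\tau_\alpha:\Pi_{k+1}\to\mathbf\Omega$ for $\alpha\in{}_k\Omega$ by $\tau_{(j)}=\tau_j$ and, for $\alpha\in{}_{k+1}\Omega$, $\tau_\alpha(\beta_0,\beta_1,\dots)=\tau_{\alpha_0}(\tau_{\alpha(0)}(\beta_0),\tau_{\alpha(1)}(\beta_1),\dots)$. **Theorem.** $\mathcal F$ has exactly one attractor $A$. For $\alpha\in{}_k\Omega$ put $A_\alpha=\overline{f_\alpha(A_{k+1})}$. For every $\alpha\in\mathbf\Omega$ the intersection $\bigcap_{k\in\mathbb N^*}A_{\alpha|_k}$ consists of exactly one point, denoted $\pi(\alpha)$, and the canonical map $\pi:\mathbf\Omega\to X$ has bounded range. Define $\pi_k:\Pi_{k+1}\to X_{k+1}^\infty$ by $\pi_0(\beta_0,\beta_1,\dots)=(\pi(\beta_0),\pi(\beta_1),\dots)$ and $\pi_{k+1}(\beta_0,\beta_1,\dots)=(\pi_k(\beta_0),\pi_k(\beta_1),\dots)$. Then for every $k\in\mathbb N^*$ and every $\alpha\in{}_k\Omega$, $$f_\alpha\circ\pi_k=\pi\circ\tau_\alpha .$$ -/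

import Mathlib

universe u v

namespace GIFS

/-! ### Nested sequences and the code space -/

/-- The iterated products of a set `X`: level `0` is `X`, and level `k + 1` consists of all
sequences of elements of level `k`. -/
def Nested (X : Type u) : ℕ → Type u
  | 0 => X
  | k + 1 => ℕ → Nested X k

/-- The finite words `(α₀, …, α_k)` with `α_i ∈ Ω_i`, where `Ω = {1, …, n}` (modelled by `Fin n`)
and `Ω_i` is the `i`-th iterated product of `Ω`. -/
abbrev Word (n k : ℕ) : Type := (i : Fin (k + 1)) → Nested (Fin n) i

/-- The code space: all sequences `(α₀, α₁, …)` with `α_i ∈ Ω_i`. -/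
abbrev Code (n : ℕ) : Type := (i : ℕ) → Nested (Fin n) i

/-- The letter `α₀ ∈ {1, …, n}` of a finite word. -/
def Word.head {n k : ℕ} (α : Word n k) : Fin n := α 0

/-- For `α = (α₀, …, α_{k+1})`, the word `α(i) = (α₁^{(i)}, …, α_{k+1}^{(i)})` made of the `i`-th
entries of the sequences `α₁, …, α_{k+1}`. -/
def Word.column {n k : ℕ} (α : Word n (k + 1)) (i : ℕ) : Word n k :=
  fun j => (show ℕ → Nested (Fin n) j from α j.succ) i

/-- The restriction `(α₀, …, α_k)` of a code. -/
def Code.restrict {n : ℕ} (α : Code n) (k : ℕ) : Word n k := fun i => α i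

/-- The canonical shift maps: if `β_i = (β_i^{(0)}, β_i^{(1)}, …)`, then
`τ_j (β₀, β₁, …) = (j, (β₀^{(0)}, β₁^{(0)}, …), (β₀^{(1)}, β₁^{(1)}, …), …)`. -/
def shift {n : ℕ} (j : Fin n) (β : ℕ → Code n) : Code n
  | 0 => j
  | k + 1 => fun i => β i k

/-- The maps `τ_α` for a word `α`: `τ_{(j)} = τ_j` and
`τ_α (β₀, β₁, …) = τ_{α₀} (τ_{α(0)} β₀, τ_{α(1)} β₁, …)`. -/
def shiftComp {n : ℕ} : (k : ℕ) → Word n k → Nested (Code n) (k + 1) → Code n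
  | 0, α, β => shift α.head β
  | k + 1, α, β => shift α.head (fun i => shiftComp k (α.column i) (β i))

/-! ### The space of bounded sequences and its iterates -/

/-- The space `ℓ_∞(Y)` of bounded sequences in a metric space `Y`, with the supremum metric
(`ℕ` is discrete, so continuity is automatic). -/
abbrev EllInf (Y : Type u) [MetricSpace Y] : Type u := BoundedContinuousFunction ℕ Y

/-- A sequence with bounded range, as an element of `ℓ_∞(Y)`. -/
def EllInf.mk {Y : Type u} [MetricSpace Y] (y : ℕ → Y)
    (hy : Bornology.IsBounded (Set.range y)) : EllInf Y where
  toFun := y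
  continuous_toFun := continuous_of_discreteTopology
  map_bounded' := by
    obtain ⟨C, hC⟩ := Metric.isBounded_iff.1 hy
    exact ⟨C, fun i j => hC ⟨i, rfl⟩ ⟨j, rfl⟩⟩

/-- The iterates of `ℓ_∞`, bundled with their metrics. -/
noncomputable def iterEllInfAux (X : Type u) [m : MetricSpace X] : ℕ → (Y : Type u) × MetricSpace Y
  | 0 => ⟨X, m⟩
  | k + 1 =>
    letI := (iterEllInfAux X k).2
    ⟨EllInf (iterEllInfAux X k).1, inferInstance⟩

/-- The spaces given by `X_0^∞ = X` and `X_{k+1}^∞ = ℓ_∞(X_k^∞)`. -/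
def IterEllInf (X : Type u) [MetricSpace X] (k : ℕ) : Type u := (iterEllInfAux X k).1

noncomputable instance (X : Type u) [MetricSpace X] (k : ℕ) : MetricSpace (IterEllInf X k) :=
  (iterEllInfAux X k).2

/-- An element of `X_{k+1}^∞` as a bounded sequence in `X_k^∞` (true by definition). -/
def IterEllInf.toSeq {X : Type u} [MetricSpace X] {k : ℕ} (x : IterEllInf X (k + 1)) :
    EllInf (IterEllInf X k) := x

/-- A bounded sequence in `X_k^∞` as an element of `X_{k+1}^∞` (true by definition). -/
def IterEllInf.ofSeq {X : Type u} [MetricSpace X] {k : ℕ} (x : EllInf (IterEllInf X k)) :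
    IterEllInf X (k + 1) := x

/-- For `A ⊆ X`, the iterated product `A_k` (`A_0 = A`, `A_{k+1} = A_k × A_k × ⋯`), as a subset
of `X_k^∞`. It is used for bounded `A`, where every sequence in `A_k` is bounded. -/
def iterProd {X : Type u} [MetricSpace X] (A : Set X) : (k : ℕ) → Set (IterEllInf X k)
  | 0 => A
  | k + 1 => {x | ∀ i, x.toSeq i ∈ iterProd A k}

/-- The coordinates of the members of a bounded subset of `ℓ_∞(Y)` form a bounded set. -/
theorem isBounded_coords {Y : Type u} [MetricSpace Y] {B : Set (EllInf Y)}
    (hB : Bornology.IsBounded B) : Bornology.IsBounded {y | ∃ x ∈ B, ∃ i, x i = y} := by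
  rcases B.eq_empty_or_nonempty with rfl | ⟨x₀, hx₀⟩
  · simp
  obtain ⟨C, hC⟩ := Metric.isBounded_iff.1 hB
  obtain ⟨D, hD⟩ := x₀.bounded
  refine (Metric.isBounded_iff_subset_closedBall (x₀ 0)).2 ⟨C + D, ?_⟩
  rintro _ ⟨x, hx, i, rfl⟩
  exact (dist_triangle _ (x₀ i) _).trans
    (add_le_add ((BoundedContinuousFunction.dist_coe_le_dist i).trans (hC hx hx₀)) (hD i 0))

/-- Bounded sequences with all terms in a fixed bounded set form a bounded subset of `ℓ_∞(Y)`. -/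
theorem isBounded_of_coords {Y : Type u} [MetricSpace Y] {S : Set Y}
    (hS : Bornology.IsBounded S) : Bornology.IsBounded {x : EllInf Y | ∀ i, x i ∈ S} := by
  obtain ⟨C, hC⟩ := Metric.isBounded_iff.1 hS
  exact Metric.isBounded_iff.2 ⟨C, fun x hx y hy =>
    (BoundedContinuousFunction.dist_le_iff_of_nonempty).2 fun i => hC (hx i) (hy i)⟩

/-- A map `π : S → X` with bounded range, applied entrywise to nested sequences. -/
noncomputable def iterMapAux {S : Type v} {X : Type u} [MetricSpace X] (π : S → X)
    (hπ : Bornology.IsBounded (Set.range π)) :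
    (k : ℕ) → {p : Nested S k → IterEllInf X k // Bornology.IsBounded (Set.range p)}
  | 0 => ⟨π, hπ⟩
  | k + 1 =>
    ⟨fun β => IterEllInf.ofSeq (EllInf.mk (fun i => (iterMapAux π hπ k).1 (β i))
        ((iterMapAux π hπ k).2.subset (by
          rintro _ ⟨i, rfl⟩
          exact ⟨_, rfl⟩))),
      (isBounded_of_coords (iterMapAux π hπ k).2).subset (by
        rintro _ ⟨β, rfl⟩ i
        exact ⟨_, rfl⟩)⟩

/-- The maps `π_k`, given by `π_0 (α₀, α₁, …) = (π α₀, π α₁, …)` and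
`π_{k+1} (α₀, α₁, …) = (π_k α₀, π_k α₁, …)`; see `iterMap_zero` and `iterMap_succ`. Since `π` has
bounded range, the values lie in `X_{k+1}^∞`. -/
noncomputable def iterMap {S : Type v} {X : Type u} [MetricSpace X] (π : S → X)
    (hπ : Bornology.IsBounded (Set.range π)) (k : ℕ) :
    Nested S (k + 1) → IterEllInf X (k + 1) :=
  (iterMapAux π hπ (k + 1)).1

theorem iterMap_zero {S : Type v} {X : Type u} [MetricSpace X] (π : S → X)
    (hπ : Bornology.IsBounded (Set.range π)) (β : Nested S 1) (i : ℕ) :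
    (iterMap π hπ 0 β).toSeq i = π (β i) := rfl

theorem iterMap_succ {S : Type v} {X : Type u} [MetricSpace X] (π : S → X)
    (hπ : Bornology.IsBounded (Set.range π)) (k : ℕ) (β : Nested S (k + 2)) (i : ℕ) :
    (iterMap π hπ (k + 1) β).toSeq i = iterMap π hπ k (β i) := rfl

/-! ### Generalized iterated function systems of infinite order -/

/-- Condition (C1): for every bounded sequence `(K_k)` of nonempty compact sets (with respect to
the Hausdorff metric), the closure of `f (∏ K_k)` is a nonempty compact set. -/
def CondC1 {X : Type u} [MetricSpace X] (f : EllInf X → X) : Prop :=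
  ∀ K : EllInf (TopologicalSpace.NonemptyCompacts X),
    ∃ L : TopologicalSpace.NonemptyCompacts X,
      (L : Set X) = closure (f '' {x | ∀ k, x k ∈ K k})

end GIFS

/-- A generalized iterated function system of infinite order: finitely many maps
`f_1, …, f_n : ℓ_∞(X) → X` satisfying (C1). -/
structure GIFSInf (n : ℕ) (X : Type u) [MetricSpace X] where
  map : Fin n → GIFS.EllInf X → X
  condC1 : ∀ i, GIFS.CondC1 (map i)

namespace GIFSInf

open GIFS

variable {n : ℕ} {X : Type u} [MetricSpace X]

/-- The maps are Lipschitz: `max_i Lip(f_i) < ∞`. -/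
def FiniteLip (F : GIFSInf n X) : Prop :=
  ∃ L : NNReal, ∀ i, LipschitzWith L (F.map i)

/-- Condition (S₁): `max_i Lip(f_i) < 1` with respect to the supremum metric on `ℓ_∞(X)`
((C1) is part of the structure). -/
def CondS1 (F : GIFSInf n X) : Prop :=
  ∃ L : NNReal, L < 1 ∧ ∀ i, LipschitzWith L (F.map i)

theorem CondS1.finiteLip {F : GIFSInf n X} (hF : F.CondS1) : F.FiniteLip :=
  let ⟨L, _, h⟩ := hF
  ⟨L, h⟩

/-- The set `cl f_1(K × K × ⋯) ∪ ⋯ ∪ cl f_n(K × K × ⋯)`. -/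
def hutchinson (F : GIFSInf n X) (K : Set X) : Set X :=
  ⋃ i, closure (F.map i '' {x | ∀ k, x k ∈ K})

/-- A nonempty compact set is an attractor of `F` if it is fixed by the Hutchinson operator. -/
def IsAttractor (F : GIFSInf n X) (A : TopologicalSpace.NonemptyCompacts X) : Prop :=
  F.hutchinson A = A

/-- The recursion defining the maps `f_α`, together with the fact that makes it meaningful: all
`f_α` with `α` of a fixed length are bounded, uniformly in `α`, on bounded sets. -/
noncomputable def compAux (F : GIFSInf n X) (hF : F.FiniteLip) :
    (k : ℕ) → {f : Word n k → IterEllInf X (k + 1) → X //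
      ∀ B, Bornology.IsBounded B → Bornology.IsBounded {y | ∃ α, ∃ x ∈ B, f α x = y}}
  | 0 => ⟨fun α x => F.map α.head x.toSeq, fun B hB => by
      obtain ⟨L, hL⟩ := hF
      have : Bornology.IsBounded (⋃ j, F.map j '' B) :=
        (Bornology.isBounded_iUnion).2 fun j => (hL j).isBounded_image hB
      refine this.subset ?_
      rintro _ ⟨α, x, hx, rfl⟩
      exact Set.mem_iUnion.2 ⟨_, x, hx, rfl⟩⟩
  | k + 1 =>
    ⟨fun α x => F.map α.head
        (EllInf.mk (fun i => (compAux F hF k).1 (α.column i) (x.toSeq i))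
          (((compAux F hF k).2 _ (isBounded_coords (B := {x.toSeq})
            Bornology.isBounded_singleton)).subset (by
              rintro _ ⟨i, rfl⟩
              exact ⟨_, _, ⟨_, rfl, i, rfl⟩, rfl⟩))),
      fun B hB => by
        obtain ⟨L, hL⟩ := hF
        have h := isBounded_of_coords ((compAux F ⟨L, hL⟩ k).2 _ (isBounded_coords hB))
        have : Bornology.IsBounded (⋃ j, F.map j '' _) :=
          (Bornology.isBounded_iUnion).2 fun j => (hL j).isBounded_image h
        refine this.subset ?_
        rintro _ ⟨α, x, hx, rfl⟩
        exact Set.mem_iUnion.2 ⟨_, _, fun i => ⟨_, _, ⟨x, hx, i, rfl⟩, rfl⟩, rfl⟩⟩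

/-- The maps `f_α : X_{k+1}^∞ → X` for words `α = (α₀, …, α_k)`: `f_{(j)} = f_j` and
`f_α (x₀, x₁, …) = f_{α₀} (f_{α(0)} x₀, f_{α(1)} x₁, …)`; see `comp_zero` and `comp_succ`. -/
noncomputable def comp (F : GIFSInf n X) (hF : F.FiniteLip) {k : ℕ} (α : Word n k) :
    IterEllInf X (k + 1) → X :=
  (F.compAux hF k).1 α

theorem comp_zero (F : GIFSInf n X) (hF : F.FiniteLip) (α : Word n 0) (x : IterEllInf X 1) :
    F.comp hF α x = F.map α.head x.toSeq := rfl

theorem isBounded_comp (F : GIFSInf n X) (hF : F.FiniteLip) {k : ℕ} (α : Word n (k + 1))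
    (x : IterEllInf X (k + 2)) :
    Bornology.IsBounded (Set.range fun i => F.comp hF (α.column i) (x.toSeq i)) :=
  ((F.compAux hF k).2 _ (isBounded_coords (B := {x.toSeq})
    Bornology.isBounded_singleton)).subset (by
      rintro _ ⟨i, rfl⟩
      exact ⟨_, _, ⟨_, rfl, i, rfl⟩, rfl⟩)

theorem comp_succ (F : GIFSInf n X) (hF : F.FiniteLip) {k : ℕ} (α : Word n (k + 1))
    (x : IterEllInf X (k + 2)) :
    F.comp hF α x = F.map α.head
      (EllInf.mk (fun i => F.comp hF (α.column i) (x.toSeq i)) (F.isBounded_comp hF α x)) := rfl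

/-- The sets `A_α = cl f_α(A_{k+1})`. -/
def tile (F : GIFSInf n X) (hF : F.FiniteLip) (A : Set X) {k : ℕ} (α : Word n k) : Set X :=
  closure (F.comp hF α '' iterProd A (k + 1))

/-- `π` is the canonical map of `F` with attractor `A`: for every code `α`, the point `π α` is the
unique element of `⋂_k A_{(α₀, …, α_k)}`. -/
def IsCanonicalMap (F : GIFSInf n X) (hF : F.FiniteLip)
    (A : TopologicalSpace.NonemptyCompacts X) (π : Code n → X) : Prop :=
  ∀ α : Code n, ⋂ k, F.tile hF A (α.restrict k) = {π α}

end GIFSInf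

open Filter Topology

namespace GIFS

variable {X : Type*} [MetricSpace X]

/-- A sequence in a bounded set is an element of `ℓ_∞`. -/
theorem EllInf.exists_eq {B : Set X} (hB : Bornology.IsBounded B) (y : ℕ → X)
    (hy : ∀ i, y i ∈ B) : ∃ x : EllInf X, ∀ i, x i = y i :=
  ⟨EllInf.mk y (hB.subset (by rintro _ ⟨i, rfl⟩; exact hy i)), fun _ => rfl⟩

theorem EllInf.dist_map_le {f : EllInf X → X} {L : NNReal} (hf : LipschitzWith L f)
    {x y : EllInf X} {C : ℝ} (h : ∀ i, dist (x i) (y i) ≤ C) : dist (f x) (f y) ≤ L * C :=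
  (hf.dist_le_mul x y).trans (mul_le_mul_of_nonneg_left
    ((BoundedContinuousFunction.dist_le_iff_of_nonempty).2 h) L.coe_nonneg)

theorem isBounded_iterProd {A : Set X} (hA : Bornology.IsBounded A) :
    ∀ k, Bornology.IsBounded (iterProd A k)
  | 0 => hA
  | k + 1 => isBounded_of_coords (Y := IterEllInf X k) (isBounded_iterProd hA k)

theorem exists_mem_iterProd {A : Set X} (hA : Bornology.IsBounded A) {k : ℕ}
    (y : ℕ → IterEllInf X k) (hy : ∀ i, y i ∈ iterProd A k) :
    ∃ x ∈ iterProd A (k + 1), ∀ i, x.toSeq i = y i := by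
  obtain ⟨x, hx⟩ := EllInf.exists_eq (isBounded_iterProd hA k) y hy
  refine ⟨IterEllInf.ofSeq x, fun i => ?_, hx⟩
  exact (hx i).symm ▸ hy i

theorem iterProd_nonempty {A : Set X} (hA : Bornology.IsBounded A) (h : A.Nonempty) :
    ∀ k, (iterProd A k).Nonempty
  | 0 => h
  | k + 1 => by
    obtain ⟨y, hy⟩ := iterProd_nonempty hA h k
    obtain ⟨x, hx, -⟩ := exists_mem_iterProd hA (fun _ => y) fun _ => hy
    exact ⟨x, hx⟩

/-- A word without its last letter. -/
def Word.init {n k : ℕ} (α : Word n (k + 1)) : Word n k := fun i => α i.castSucc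

end GIFS

namespace GIFSInf

open GIFS

variable {n : ℕ} {X : Type*} [MetricSpace X]

/-! ### The attractor -/

theorem exists_hutchinson_eq (hn : 0 < n) (F : GIFSInf n X)
    (K : TopologicalSpace.NonemptyCompacts X) :
    ∃ K' : TopologicalSpace.NonemptyCompacts X, (K' : Set X) = F.hutchinson K := by
  choose M hM using fun i => F.condC1 i (BoundedContinuousFunction.const ℕ K)
  refine ⟨⟨⟨⋃ i, (M i : Set X), isCompact_iUnion fun i => (M i).isCompact⟩, ?_⟩, ?_⟩
  · exact (M ⟨0, hn⟩).nonempty.mono (Set.subset_iUnion (fun i => (M i : Set X)) _)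
  · exact Set.iUnion_congr fun i => hM i

theorem exists_dist_le_of_mem_hutchinson (F : GIFSInf n X) {L : NNReal}
    (hL : ∀ i, LipschitzWith L (F.map i)) (K K' : TopologicalSpace.NonemptyCompacts X)
    {z : X} (hz : z ∈ F.hutchinson K) :
    Metric.infDist z (F.hutchinson K') ≤ L * dist K K' := by
  obtain ⟨i, hi⟩ := Set.mem_iUnion.1 hz
  refine closure_minimal (s := F.map i '' {x | ∀ k, x k ∈ (K : Set X)})
    (t := {z | Metric.infDist z (F.hutchinson K') ≤ L * dist K K'}) ?_
    (isClosed_le (Metric.continuous_infDist_pt _) continuous_const) hi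
  rintro _ ⟨x, hx, rfl⟩
  have h : ∀ k, ∃ y ∈ (K' : Set X), dist (x k) y ≤ dist K K' := fun k => by
    obtain ⟨y, hy, h⟩ := K'.isCompact.exists_infDist_eq_dist K'.nonempty (x k)
    refine ⟨y, hy, h ▸ Metric.infDist_le_hausdorffDist_of_mem (hx k) ?_⟩
    exact Metric.hausdorffEDist_ne_top_of_nonempty_of_bounded K.nonempty K'.nonempty
      K.isCompact.isBounded K'.isCompact.isBounded
  choose y hy hxy using h
  obtain ⟨y', hy'⟩ := EllInf.exists_eq K'.isCompact.isBounded y hy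
  have hmem : F.map i y' ∈ F.hutchinson K' :=
    Set.mem_iUnion.2 ⟨i, subset_closure ⟨y', fun k => (hy' k).symm ▸ hy k, rfl⟩⟩
  refine (Metric.infDist_le_dist_of_mem hmem).trans ?_
  exact EllInf.dist_map_le (hL i) fun k => (hy' k).symm ▸ hxy k

theorem existsUnique_isAttractor [CompleteSpace X] [Nonempty X] (hn : 0 < n) (F : GIFSInf n X)
    (hF : F.CondS1) : ∃! A : TopologicalSpace.NonemptyCompacts X, F.IsAttractor A := by
  obtain ⟨L, hL1, hL⟩ := hF
  choose H hH using F.exists_hutchinson_eq hn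
  have hc : ContractingWith L H := by
    refine ⟨hL1, LipschitzWith.of_dist_le_mul fun K K' => ?_⟩
    refine Metric.hausdorffDist_le_of_infDist (by positivity) ?_ ?_
    · intro z hz
      rw [hH] at hz ⊢
      exact F.exists_dist_le_of_mem_hutchinson hL K K' hz
    · intro z hz
      rw [hH] at hz ⊢
      rw [dist_comm K K']
      exact F.exists_dist_le_of_mem_hutchinson hL K' K hz
  have hiff : ∀ A, F.IsAttractor A ↔ Function.IsFixedPt H A := fun A => by
    rw [IsAttractor, ← hH, Function.IsFixedPt, SetLike.coe_set_eq]
  refine ⟨hc.fixedPoint, (hiff _).2 hc.fixedPoint_isFixedPt, fun A hA => ?_⟩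
  exact hc.fixedPoint_unique ((hiff A).1 hA)

/-! ### The tiles of the attractor -/

variable {F : GIFSInf n X} {A : TopologicalSpace.NonemptyCompacts X}

theorem IsAttractor.map_mem (hA : F.IsAttractor A) (i : Fin n) {x : EllInf X}
    (hx : ∀ k, x k ∈ (A : Set X)) : F.map i x ∈ (A : Set X) := by
  rw [← show F.hutchinson A = A from hA]
  exact Set.mem_iUnion.2 ⟨i, subset_closure ⟨x, hx, rfl⟩⟩

theorem IsAttractor.comp_mem (hA : F.IsAttractor A) (hF : F.FiniteLip) {k : ℕ} (α : Word n k)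
    {x : IterEllInf X (k + 1)} (hx : x ∈ iterProd (A : Set X) (k + 1)) :
    F.comp hF α x ∈ (A : Set X) := by
  induction k with
  | zero => exact hA.map_mem _ hx
  | succ k ih => exact hA.map_mem _ fun i => ih (α.column i) (hx i)

theorem IsAttractor.tile_subset (hA : F.IsAttractor A) (hF : F.FiniteLip) {k : ℕ}
    (α : Word n k) : F.tile hF A α ⊆ A :=
  closure_minimal (by rintro _ ⟨x, hx, rfl⟩; exact hA.comp_mem hF α hx) A.isCompact.isClosed

theorem tile_nonempty (hF : F.FiniteLip) {k : ℕ} (α : Word n k) : (F.tile hF A α).Nonempty :=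
  ((iterProd_nonempty A.isCompact.isBounded A.nonempty _).image _).closure

theorem dist_comp_le (hF : F.FiniteLip) {L : NNReal} (hL : ∀ i, LipschitzWith L (F.map i))
    {A : Set X} {D : ℝ} (hD : ∀ x ∈ A, ∀ y ∈ A, dist x y ≤ D) {k : ℕ} (α : Word n k)
    {x y : IterEllInf X (k + 1)} (hx : x ∈ iterProd A (k + 1)) (hy : y ∈ iterProd A (k + 1)) :
    dist (F.comp hF α x) (F.comp hF α y) ≤ L ^ (k + 1) * D := by
  induction k with
  | zero =>
    rw [zero_add, pow_one]
    exact EllInf.dist_map_le (hL _) fun i => hD _ (hx i) _ (hy i)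
  | succ k ih =>
    rw [pow_succ', mul_assoc]
    exact EllInf.dist_map_le (hL _) fun i => ih (α.column i) (hx i) (hy i)

/-- If each `y i` is a value of `f_{α(i)}` on an iterated product of the bounded set `A`, then
`f_{α₀} (y₀, y₁, …)` is a value of `f_α`. -/
theorem map_mem_image_comp (hF : F.FiniteLip) {A : Set X} (hA : Bornology.IsBounded A) {k : ℕ}
    (α : Word n (k + 1)) {y : EllInf X}
    (hy : ∀ i, y i ∈ F.comp hF (α.column i) '' iterProd A (k + 1)) :
    F.map α.head y ∈ F.comp hF α '' iterProd A (k + 2) := by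
  choose x hx hxy using hy
  obtain ⟨x', hx', h⟩ := exists_mem_iterProd hA x hx
  refine ⟨x', hx', ?_⟩
  rw [comp_succ]
  congr 1
  ext i
  exact (congrArg _ (h i)).trans (hxy i)

theorem IsAttractor.image_comp_subset (hA : F.IsAttractor A) (hF : F.FiniteLip) {k : ℕ}
    (α : Word n (k + 1)) :
    F.comp hF α '' iterProd (A : Set X) (k + 2) ⊆
      F.comp hF α.init '' iterProd (A : Set X) (k + 1) := by
  induction k with
  | zero =>
    rintro _ ⟨x, hx, rfl⟩
    refine ⟨IterEllInf.ofSeq (EllInf.mk _ (F.isBounded_comp hF α x)), fun i => ?_, rfl⟩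
    exact hA.comp_mem hF (α.column i) (hx i)
  | succ k ih =>
    rintro _ ⟨x, hx, rfl⟩
    rw [comp_succ]
    exact map_mem_image_comp hF A.isCompact.isBounded α.init
      fun i => ih (α.column i) ⟨x.toSeq i, hx i, rfl⟩

theorem IsAttractor.antitone_tile (hA : F.IsAttractor A) (hF : F.FiniteLip) (α : Code n) :
    Antitone fun k => F.tile hF A (α.restrict k) :=
  antitone_nat_of_succ_le fun k => closure_mono (hA.image_comp_subset hF (α.restrict (k + 1)))

theorem tendsto_diam_tile (hF : F.FiniteLip) {L : NNReal} (hL1 : L < 1)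
    (hL : ∀ i, LipschitzWith L (F.map i)) (α : Code n) :
    Tendsto (fun k => Metric.diam (F.tile hF A (α.restrict k))) atTop (𝓝 0) := by
  have h : Tendsto (fun k : ℕ => (L : ℝ) ^ (k + 1) * Metric.diam (A : Set X)) atTop (𝓝 0) := by
    simpa using ((tendsto_pow_atTop_nhds_zero_of_lt_one L.coe_nonneg
      (NNReal.coe_lt_one.2 hL1)).comp (tendsto_add_atTop_nat 1)).mul_const
        (Metric.diam (A : Set X))
  refine squeeze_zero (fun _ => Metric.diam_nonneg) (fun k => ?_) h
  rw [tile, Metric.diam_closure]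
  refine Metric.diam_le_of_forall_dist_le
    (mul_nonneg (pow_nonneg L.coe_nonneg _) Metric.diam_nonneg) ?_
  rintro _ ⟨x, hx, rfl⟩ _ ⟨y, hy, rfl⟩
  exact dist_comp_le hF hL (fun _ hx _ hy =>
    Metric.dist_le_diam_of_mem A.isCompact.isBounded hx hy) _ hx hy

theorem IsAttractor.exists_iInter_tile_eq [CompleteSpace X] (hA : F.IsAttractor A)
    (hF : F.CondS1) (α : Code n) :
    ∃ p, ⋂ k, F.tile hF.finiteLip A (α.restrict k) = {p} := by
  obtain ⟨L, hL1, hL⟩ := id hF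
  have hb : ∀ k, Bornology.IsBounded (F.tile hF.finiteLip A (α.restrict k)) := fun k =>
    A.isCompact.isBounded.subset (hA.tile_subset _ _)
  have hd := tendsto_diam_tile (A := A) hF.finiteLip hL1 hL α
  have hne : ∀ k, (⋂ j ≤ k, F.tile hF.finiteLip A (α.restrict j)).Nonempty := fun k =>
    (tile_nonempty hF.finiteLip (α.restrict k)).mono
      (Set.subset_iInter₂ fun j hj => hA.antitone_tile hF.finiteLip α hj)
  obtain ⟨p, hp⟩ := Metric.nonempty_iInter_of_nonempty_biInter
    (fun k => isClosed_closure) hb hne hd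
  refine ⟨p, Set.eq_singleton_iff_unique_mem.2 ⟨hp, fun q hq => ?_⟩⟩
  refine dist_le_zero.1 (ge_of_tendsto' hd fun k => ?_)
  exact Metric.dist_le_diam_of_mem (hb k) (Set.mem_iInter.1 hq k) (Set.mem_iInter.1 hp k)

/-! ### The canonical map -/

variable {π : Code n → X}

theorem IsCanonicalMap.mem_tile {hF : F.FiniteLip} (h : F.IsCanonicalMap hF A π) (α : Code n)
    (k : ℕ) : π α ∈ F.tile hF A (α.restrict k) :=
  Set.mem_iInter.1 ((h α).symm ▸ Set.mem_singleton (π α)) k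

theorem IsCanonicalMap.isBounded_range {hF : F.FiniteLip} (h : F.IsCanonicalMap hF A π)
    (hA : F.IsAttractor A) : Bornology.IsBounded (Set.range π) :=
  A.isCompact.isBounded.subset (by
    rintro _ ⟨α, rfl⟩
    exact hA.tile_subset hF _ (h.mem_tile α 0))

/-- The canonical map intertwines the maps of the system with the canonical shifts. -/
theorem IsCanonicalMap.map_eq {hF : F.FiniteLip} (h : F.IsCanonicalMap hF A π)
    (hA : F.IsAttractor A) (j : Fin n) (β : ℕ → Code n) {x : EllInf X}
    (hx : ∀ i, x i = π (β i)) : F.map j x = π (shift j β) := by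
  obtain ⟨L, hL⟩ := id hF
  rw [← Set.mem_singleton_iff, ← h, Set.mem_iInter]
  rintro (_ | k)
  · exact subset_closure ⟨IterEllInf.ofSeq x,
      fun i => (hx i).symm ▸ hA.tile_subset hF _ (h.mem_tile (β i) 0), rfl⟩
  · refine Metric.mem_closure_iff.2 fun ε hε => ?_
    have hδ : 0 < ε / (L + 1) := by positivity
    choose y hy hxy using fun i => Metric.mem_closure_iff.1 (h.mem_tile (β i) k) _ hδ
    have hyA : ∀ i, y i ∈ (A : Set X) := fun i => hA.tile_subset hF _ (subset_closure (hy i))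
    obtain ⟨y', hy'⟩ := EllInf.exists_eq A.isCompact.isBounded y hyA
    refine ⟨F.map j y', map_mem_image_comp hF A.isCompact.isBounded
      ((shift j β).restrict (k + 1)) fun i => (hy' i).symm ▸ hy i, ?_⟩
    calc dist (F.map j x) (F.map j y') ≤ L * (ε / (L + 1)) :=
          EllInf.dist_map_le (hL j) fun i => by rw [hx, hy']; exact (hxy i).le
      _ < (L + 1) * (ε / (L + 1)) := mul_lt_mul_of_pos_right (lt_add_one _) hδ
      _ = ε := mul_div_cancel₀ _ (by positivity)

theorem IsCanonicalMap.comp_iterMap {hF : F.FiniteLip} (h : F.IsCanonicalMap hF A π)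
    (hA : F.IsAttractor A) (hπ : Bornology.IsBounded (Set.range π)) {k : ℕ} (α : Word n k)
    (β : Nested (Code n) (k + 1)) :
    F.comp hF α (iterMap π hπ k β) = π (shiftComp k α β) := by
  induction k with
  | zero => exact h.map_eq hA α.head β fun _ => rfl
  | succ k ih => exact h.map_eq hA α.head _ fun i => ih (α.column i) (β i)

end GIFSInf

theorem theorem5p13 {X : Type*} [MetricSpace X] [CompleteSpace X] [Nonempty X] {n : ℕ}
    (hn : 0 < n) (F : GIFSInf n X) (hF : F.CondS1) :
    (∃! A : TopologicalSpace.NonemptyCompacts X, F.IsAttractor A) ∧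
      ∀ A : TopologicalSpace.NonemptyCompacts X, F.IsAttractor A →
        ∃ π : GIFS.Code n → X, F.IsCanonicalMap hF.finiteLip A π ∧
          ∃ hπ : Bornology.IsBounded (Set.range π),
            ∀ (k : ℕ) (α : GIFS.Word n k),
              F.comp hF.finiteLip α ∘ GIFS.iterMap π hπ k = π ∘ GIFS.shiftComp k α := by
  refine ⟨F.existsUnique_isAttractor hn hF, fun A hA => ?_⟩
  choose π hπ using hA.exists_iInter_tile_eq hF
  have h : F.IsCanonicalMap hF.finiteLip A π := hπ
  have hb := h.isBounded_range hA
  exact ⟨π, h, hb, fun k α => funext (h.comp_iterMap hA hb α)⟩
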